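/- **Setting.** Let $f\colon\mathbb{R}^n\to\mathbb{R}$ and $c_i\colon\mathbb{R}^n\to\mathbb{R}$ ($i\in\mathcal I\cup\mathcal E$, $|\mathcal I|=m_{\mathcal I}$, $|\mathcal E|=m_{\mathcal E}$, $m=m_{\mathcal I}+m_{\mathcal E}$) be $d\ge 3$ times continuously differentiable, and consider the problem of minimizing $f(x)$ subject to $c_{\mathcal I}(x)\ge 0$, $c_{\mathcal E}(x)=0$. Write $w=(x,\lambda)\in\mathbb{R}^{n+m}$, $A(x)$ for the Jacobian of $c$, and $$F^\mu(w)=\begin{pmatrix}\nabla f(x)-A(x)^T\lambda\\ \bigl(c_i(x)\lambda_i-\mu\bigr)_{i\in\mathcal I}\\ c_{\mathcal E}(x)\end{pmatrix},$$ whose Jacobian $J_F(w)$ does not depend on $\mu$; $\|\cdot\|$ is the Euclidean norm. Let $w^*=(x^*,\lambda^*)$ be a KKT point with its multiplier vector, i.e. $\nabla f(x^*)=A(x^*)^T\lambda^*$, $c_{\mathcal I}(x^*)\ge0$, $c_{\mathcal E}(x^*)=0$, $\lambda^*_{\mathcal I}\ge 0$ and $c_i(x^*)\lambda_i^*=0$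 for $i\in\mathcal I$. Assume: (LICQ) the gradients $\nabla c_i(x^*)$ of the active constraints (those with $c_i(x^*)=0$) are linearly independent; (strict complementarity) $\lambda_i^*>0$ for all active $i\in\mathcal I$; (strong second-order sufficiency) there is $\omega>0$ with $v^TH(x^*,\lambda^*)v\ge\omega\|v\|^2$ for all $v$ with $\nabla c_i(x^*)^Tv=0$ for all active $i$, where $H$ is the Hessian with respect to $x$ of the Lagrangian $f(x)-\lambda^Tc(x)$. **Extrapolation step.** For $w$ with $J_F(w)$ invertible, let $r=F^{\mu}(w)$, let $\operatorname{nml}(r)=r/\|r\|$ ($\operatorname{nml}(0)=0$), and let $u$ be the smooth curve, unique near $\rho=\|r\|$, with $u(\|r\|)=w$ and $F^{\mu}(u(\rho))=\rho\operatorname{nml}(r)$. The extrapolation point of order $p$ is $\sum_{q=0}^p\frac1{q!}u^{(q)}(\|r\|)(0-\|r\|)^q$. **Algorithm.** Let $p\in\{1,\dots,d-2\}$, $\kappa\in(1,p+1)$, and let $\epsilon,\varphi$ be positive functions on $(0,\infty)$ with $\epsilon(\mu)=\Theta(\mu)$ and $\varphi(\mu)=\Theta(\mu^\kappa)$ as $\mu\downarrow0$.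 Start from any $w_0$ and $\mu_0>0$. In iteration $k$, let $\bar w_k$ be the extrapolation point of order $p$ of $w_k$ for barrier parameter $\mu_k$ if $J_F(w_k)$ is invertible, and $\bar w_k=w_k$ otherwise. If $\|F^{\mu_k}(\bar w_k)\|\le\epsilon(\mu_k)$, set $w_{k+1}=\bar w_k$; otherwise an arbitrary inner minimization method supplies some $w_{k+1}$ with $\|F^{\mu_k}(w_{k+1})\|\le\epsilon(\mu_k)$. Set $\mu_{k+1}=\varphi(\mu_k)$ and continue indefinitely. Assume $\mu_k\to0$. **Theorem.** Suppose that some subsequence of the iterates $(w_{k+1})_k$ converges to $w^*$. Then: 1. the whole sequence $(w_k)$ converges to $w^*$; 2. ultimately the inner minimization is not used: for all sufficiently large $k$, $J_F(w_k)$ is invertible, the extrapolation point $\bar w_k$ satisfies $\|F^{\mu_k}(\bar w_k)\|\le\epsilon(\mu_k)$, and $w_{k+1}=\bar w_k$; 3. for every component $j$, $[w_k]_j$ converges to $[w^*]_j$ with R-order $\kappa$: $|[w_k-w^*]_j|\le v_k$ for all $k$, for some sequence $(v_k)$ that converges to $0$ with Q-order $\kappa$; 4. there is a map $W\colon\mathbb{R}^{n+m}\to\mathbb{R}^{n+m}$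 that is $d-1$ times continuously differentiable near $0$, with $W(0)=w^*$ and $F^0(W(r))=r$ for $r$ near $0$; and for every such $W$, with $w^{w^*}(\mu)=W\bigl((0,\mu e,0)\bigr)$ the barrier trajectory ($e$ the all-ones vector in the inequality block), for every component $j$ with $[\dot w^{w^*}(0)]_j\ne0$, $[w_k]_j$ converges to $[w^*]_j$ with Q-order $\kappa$. Here a real sequence $(u_k)$ converges to $a$ with Q-order $\kappa$ if $u_k\to a$, $u_k\ne a$ for all large $k$, and $|u_{k+1}-a|=\Theta\bigl(|u_k-a|^\kappa\bigr)$ as $k\to\infty$. -/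

import Mathlib

open Filter Topology Asymptotics

noncomputable section

/-- The data of the problem: minimize `f x` subject to `c (inl i) x ≥ 0` for the `mI` inequality
constraints and `c (inr i) x = 0` for the `mE` equality constraints, `x ∈ ℝⁿ`. -/
structure NLP (n mI mE : ℕ) where
  /-- objective function -/
  f : EuclideanSpace ℝ (Fin n) → ℝ
  /-- constraint functions, inequalities first -/
  c : Fin mI ⊕ Fin mE → EuclideanSpace ℝ (Fin n) → ℝ

/-- The space `ℝ^(n+m)` of primal-dual points `w = (x, λ)`, with the Euclidean norm. -/
abbrev PrimalDual (n mI mE : ℕ) : Type :=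
  EuclideanSpace ℝ (Fin n ⊕ (Fin mI ⊕ Fin mE))

/-- The part `x` of `w = (x, λ)`. -/
def primal {n mI mE : ℕ} (w : PrimalDual n mI mE) : EuclideanSpace ℝ (Fin n) :=
  WithLp.toLp 2 (fun i => w (Sum.inl i))

/-- The part `λ` of `w = (x, λ)`. -/
def dual {n mI mE : ℕ} (w : PrimalDual n mI mE) : Fin mI ⊕ Fin mE → ℝ :=
  fun i => w (Sum.inr i)

/-- The vector `(0, e, 0)`, whose blocks have lengths `n`, `mI`, `mE`. -/
def barrierDirection (n mI mE : ℕ) : PrimalDual n mI mE :=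
  WithLp.toLp 2 (Sum.elim (fun _ => 0) (Sum.elim (fun _ => 1) (fun _ => 0)))

/-- `nml r = r / ‖r‖` for `r ≠ 0`, and `nml 0 = 0`. -/
def nml {n mI mE : ℕ} (r : PrimalDual n mI mE) : PrimalDual n mI mE := ‖r‖⁻¹ • r

namespace NLP

variable {n mI mE : ℕ} (P : NLP n mI mE)

/-- All problem functions are `d` times continuously differentiable. -/
def IsSmooth (d : ℕ) : Prop :=
  ContDiff ℝ d P.f ∧ ∀ i, ContDiff ℝ d (P.c i)

/-- The residual of the perturbed optimality conditions,
`F^μ(x, λ) = (∇f(x) - A(x)ᵀ λ, C_I(x) λ_I - μ e, c_E(x))`. -/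
def residual (μ : ℝ) (w : PrimalDual n mI mE) : PrimalDual n mI mE :=
  WithLp.toLp 2 (Sum.elim
    (fun i => gradient P.f (primal w) i - ∑ j, dual w j * gradient (P.c j) (primal w) i)
    (Sum.elim
      (fun i => P.c (Sum.inl i) (primal w) * dual w (Sum.inl i) - μ)
      (fun i => P.c (Sum.inr i) (primal w))))

/-- The Jacobian of `F^μ` at `w`; it does not depend on `μ`. -/
def jacobian (w : PrimalDual n mI mE) : PrimalDual n mI mE →L[ℝ] PrimalDual n mI mE :=
  fderiv ℝ (P.residual 0) w

/-- The Lagrangian `f(x) - λᵀ c(x)`. -/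
def lagrangian (x : EuclideanSpace ℝ (Fin n)) (l : Fin mI ⊕ Fin mE → ℝ) : ℝ :=
  P.f x - ∑ i, l i * P.c i x

/-- The quadratic form `v ↦ vᵀ H(x, λ) v`, with `H` the Hessian in `x` of the Lagrangian. -/
def hessianForm (x : EuclideanSpace ℝ (Fin n)) (l : Fin mI ⊕ Fin mE → ℝ)
    (v : EuclideanSpace ℝ (Fin n)) : ℝ :=
  fderiv ℝ (fun y => fderiv ℝ (fun z => P.lagrangian z l) y) x v v

/-- `x` is a KKT point with Lagrange multiplier vector `λ`, where `w = (x, λ)`. -/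
structure IsKKT (w : PrimalDual n mI mE) : Prop where
  stationary : gradient P.f (primal w) = ∑ i, dual w i • gradient (P.c i) (primal w)
  ineq_feasible : ∀ i, 0 ≤ P.c (Sum.inl i) (primal w)
  eq_feasible : ∀ i, P.c (Sum.inr i) (primal w) = 0
  multiplier_nonneg : ∀ i, 0 ≤ dual w (Sum.inl i)
  complementary : ∀ i, P.c (Sum.inl i) (primal w) * dual w (Sum.inl i) = 0

/-- Linear independence constraint qualification at `x`: the gradients of the active constraints
are linearly independent. -/
def LICQ (x : EuclideanSpace ℝ (Fin n)) : Prop :=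
  LinearIndependent ℝ (fun i : {i // P.c i x = 0} => gradient (P.c i.1) x)

/-- Strict complementarity: the multipliers of active inequality constraints are positive. -/
def StrictComplementarity (w : PrimalDual n mI mE) : Prop :=
  ∀ i, P.c (Sum.inl i) (primal w) = 0 → 0 < dual w (Sum.inl i)

/-- Strong second-order sufficiency: the Hessian of the Lagrangian is uniformly positive on the
vectors orthogonal to all active constraint gradients. -/
def StrongSecondOrder (w : PrimalDual n mI mE) : Prop :=
  ∃ ω : ℝ, 0 < ω ∧ ∀ v : EuclideanSpace ℝ (Fin n),
    (∀ i, P.c i (primal w) = 0 → inner ℝ (gradient (P.c i) (primal w)) v = 0) →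
      ω * ‖v‖ ^ 2 ≤ P.hessianForm (primal w) (dual w) v

/-- `W` is the (locally unique) local inverse of `F^0` with `W 0 = w*`, of class `C^(d-1)` near `0`.
The barrier trajectory is then `μ ↦ W (μ • (0, e, 0))`. -/
structure IsTrajectoryMap (d : ℕ) (wstar : PrimalDual n mI mE)
    (W : PrimalDual n mI mE → PrimalDual n mI mE) : Prop where
  smooth : ContDiffAt ℝ ((d - 1 : ℕ) : WithTop ℕ∞) W 0
  solves : ∀ᶠ r in 𝓝 0, P.residual 0 (W r) = r
  base : W 0 = wstar

/-- `w'` is the point `w^p` obtained from `w` by the extrapolation step of order `p` for barrier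
parameter `μ`: with `r = F^μ(w)`, and `u` the smooth curve through `u(‖r‖) = w` that satisfies
`F^μ(u(ρ)) = ρ nml(r)` for `ρ` near `‖r‖`, it is the value at `ρ = 0` of the Taylor polynomial of
order `p` of `u` at `‖r‖`. If the Jacobian at `w` is invertible, the germ of `u` at `‖r‖` exists
and is unique by the inverse function theorem, and hence so is `w'`. -/
def IsExtrapolation (p : ℕ) (μ : ℝ) (w w' : PrimalDual n mI mE) : Prop :=
  ∃ u : ℝ → PrimalDual n mI mE,
    ContDiffAt ℝ p u ‖P.residual μ w‖ ∧
    u ‖P.residual μ w‖ = w ∧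
    (∀ᶠ ρ in 𝓝 ‖P.residual μ w‖, P.residual μ (u ρ) = ρ • nml (P.residual μ w)) ∧
    w' = ∑ q ∈ Finset.range (p + 1),
      ((q.factorial : ℝ)⁻¹ * (0 - ‖P.residual μ w‖) ^ q) •
        iteratedDeriv q u ‖P.residual μ w‖

/-- `μ`, `w`, `wbar` are the barrier parameters, the iterates and the starting points of the inner
minimization in a run, without stopping criterion, of the extrapolation interior-point method.
The inner minimization method is arbitrary: when `wbar k` fails the termination criterion, the
next iterate may be any point that fulfills it; otherwise, it is not applied. -/
structure IsRun (p : ℕ) (ε φ : ℝ → ℝ) (μ : ℕ → ℝ) (w wbar : ℕ → PrimalDual n mI mE) : Prop where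
  initial_pos : 0 < μ 0
  update : ∀ k, μ (k + 1) = φ (μ k)
  extrapolate : ∀ k, (P.jacobian (w k)).IsInvertible → P.IsExtrapolation p (μ k) (w k) (wbar k)
  no_extrapolate : ∀ k, ¬ (P.jacobian (w k)).IsInvertible → wbar k = w k
  accept : ∀ k, ‖P.residual (μ k) (wbar k)‖ ≤ ε (μ k) → w (k + 1) = wbar k
  terminate : ∀ k, ‖P.residual (μ k) (w (k + 1))‖ ≤ ε (μ k)

end NLP

/-- Q-convergence of order `κ` of a real sequence `u` to `a`: the errors tend to zero, are
ultimately nonzero, and the ratios `|u (k+1) - a| / |u k - a|^κ` are ultimately bounded above and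
bounded away from zero. -/
def QConvergesWithOrder (κ : ℝ) (u : ℕ → ℝ) (a : ℝ) : Prop :=
  Tendsto u atTop (𝓝 a) ∧ (∀ᶠ k in atTop, u k ≠ a) ∧
    (fun k => u (k + 1) - a) =Θ[atTop] (fun k => |u k - a| ^ κ)

/-- R-convergence of order `κ`: the errors are dominated by a sequence that converges to zero with
Q-order `κ`. -/
def RConvergesWithOrder (κ : ℝ) (u : ℕ → ℝ) (a : ℝ) : Prop :=
  ∃ v : ℕ → ℝ, (∀ k, |u k - a| ≤ v k) ∧ QConvergesWithOrder κ v 0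

end

/-! ### Taylor estimates along lines and the inverse function theorem -/

section Analysis

variable {E G : Type*} [NormedAddCommGroup E] [NormedSpace ℝ E]
  [NormedAddCommGroup G] [NormedSpace ℝ G]

/-! The regularity conditions make the Jacobian nonsingular at `w*`
(`NLP.IsKKT.isInvertible_jacobian`), so `F^0` has a local inverse `W` of class `C^(d-1)`. Since `μ`
enters `F^μ` only as a translation by `μ e`, near `w*` the extrapolation curve is `ρ ↦ W (μ e + ρ
nml r)`, the image of a segment that starts at `μ e`. The extrapolation point is thus a Taylor value
approximating the trajectory point `W (μ e)`, with error `O(‖r‖^(p+1))` uniformly in `w` and `μ`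
(`NLP.exists_norm_extrapolation_sub_le`).

The termination test at step `k` gives `‖F^{μ_{k+1}}(w_{k+1})‖ = O(μ_k)`, so the error is
`O(μ_k^(p+1))`, which is `o(μ_{k+1})` because `κ < p + 1`. Hence the residual of the extrapolation
point is `o(μ_{k+1})`, below `ε(μ_{k+1}) = Θ(μ_{k+1})`: the point is accepted and stays near `w*`
(`NLP.IsRun.exists_ball_step`). One late iterate near `w*` therefore traps all later ones, and
`w_{k+1} = w* + μ_k ẇ(0) + o(μ_k)`. The rates of the components are inherited from `μ_{k+1} =
Θ(μ_k^κ)`. -/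

/-- The derivatives of `W` along a line are controlled by those of `W`. -/
theorem norm_iteratedDeriv_comp_line_le {W : E → G} {N : ℕ} (hW : ContDiff ℝ N W) (a v : E)
    (t : ℝ) :
    ‖iteratedDeriv N (fun ρ : ℝ => W (a + ρ • v)) t‖ ≤
      ‖iteratedFDeriv ℝ N W (a + t • v)‖ * ‖v‖ ^ N := by
  have hline : (fun ρ : ℝ => W (a + ρ • v)) =
      (fun x => W (a + x)) ∘ ContinuousLinearMap.toSpanSingleton ℝ v := by
    ext ρ; simp
  have hcd : ContDiff ℝ N (fun x => W (a + x)) := hW.comp (contDiff_const.add contDiff_id)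
  rw [← norm_iteratedFDeriv_eq_norm_iteratedDeriv, hline,
    ContinuousLinearMap.iteratedFDeriv_comp_right _ hcd t le_rfl]
  refine (ContinuousMultilinearMap.norm_compContinuousLinearMap_le _ _).trans_eq ?_
  rw [iteratedFDeriv_comp_add_left]
  simp

/-- Uniform Taylor estimate along segments of bounded length ending at a bounded base point,
expanded at the far end of the segment. -/
theorem exists_norm_taylor_line_sub_le [FiniteDimensional ℝ E] {W : E → G} {p : ℕ}
    (hW : ContDiff ℝ (p + 1 : ℕ) W) (R : ℝ) :
    ∃ C, 0 ≤ C ∧ ∀ a v : E, ∀ s : ℝ, ‖a‖ ≤ R → ‖v‖ ≤ 1 → 0 ≤ s → s ≤ R →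
      ‖∑ q ∈ Finset.range (p + 1), ((q.factorial : ℝ)⁻¹ * (0 - s) ^ q) •
        iteratedDeriv q (fun ρ : ℝ => W (a + ρ • v)) s - W a‖ ≤ C * s ^ (p + 1) := by
  have hcont : ContinuousOn (iteratedFDeriv ℝ (p + 1) W) (Metric.closedBall 0 (R + R)) :=
    (hW.continuous_iteratedFDeriv le_rfl).continuousOn
  obtain ⟨M, hM⟩ := (isCompact_closedBall (0 : E) (R + R)).exists_bound_of_continuousOn hcont
  refine ⟨max M 0, le_max_right _ _, fun a v s ha hv hs hsR => ?_⟩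
  -- The case `s = 0` is separate because `Icc 0 s` must be nondegenerate for unique derivatives.
  rcases hs.eq_or_lt with rfl | hs
  · rw [Finset.sum_eq_single_of_mem 0 (by simp) (fun q _ hq => by simp [hq])]
    simp
  set g : ℝ → G := fun ρ => W (a + ρ • v) with hg
  have hgc : ContDiff ℝ (p + 1 : ℕ) g := by fun_prop
  -- The Taylor bound used below expands at the left endpoint, so the segment is reversed; the signs
  -- `(-1)^q` turn `s^q` into `(0 - s)^q`.
  have hgc' : ContDiff ℝ (p + 1 : ℕ) (fun t => g (s - t)) := by fun_prop
  have hwithin : ∀ q ≤ p + 1, ∀ t ∈ Set.Icc (0 : ℝ) s,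
      iteratedDerivWithin q (fun t => g (s - t)) (Set.Icc 0 s) t =
        (-1 : ℝ) ^ q • iteratedDeriv q g (s - t) := by
    intro q hq t ht
    rw [iteratedDerivWithin_eq_iteratedDeriv (uniqueDiffOn_Icc hs)
      ((hgc'.of_le (by exact_mod_cast hq)).contDiffAt) ht, iteratedDeriv_comp_const_sub]
  have key := taylor_mean_remainder_bound (f := fun t => g (s - t)) (n := p) (C := max M 0) hs.le
    (by exact_mod_cast hgc'.contDiffOn) (Set.right_mem_Icc.2 hs.le) (fun y hy => by
      rw [hwithin _ le_rfl y hy, norm_smul, norm_pow, norm_neg, norm_one, one_pow, one_mul]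
      refine (norm_iteratedDeriv_comp_line_le hW a v (s - y)).trans ?_
      have h1 : ‖v‖ ^ (p + 1) ≤ 1 := pow_le_one₀ (norm_nonneg _) hv
      have h2 : ‖iteratedFDeriv ℝ (p + 1) W (a + (s - y) • v)‖ ≤ M := by
        apply hM
        rw [mem_closedBall_zero_iff]
        refine (norm_add_le _ _).trans (add_le_add ha ?_)
        rw [norm_smul, Real.norm_of_nonneg (sub_nonneg.2 hy.2)]
        nlinarith [hy.1, hy.2, norm_nonneg v]
      exact (mul_le_of_le_one_right (norm_nonneg _) h1).trans (h2.trans (le_max_left _ _)))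
  rw [taylor_within_apply, norm_sub_rev] at key
  have hsum : ∑ q ∈ Finset.range (p + 1), ((q.factorial : ℝ)⁻¹ * (s - 0) ^ q) •
      iteratedDerivWithin q (fun t => g (s - t)) (Set.Icc 0 s) 0 =
      ∑ q ∈ Finset.range (p + 1), ((q.factorial : ℝ)⁻¹ * (0 - s) ^ q) • iteratedDeriv q g s := by
    refine Finset.sum_congr rfl fun q hq => ?_
    rw [hwithin q (Finset.mem_range.1 hq).le 0 (Set.left_mem_Icc.2 hs.le), smul_smul, sub_zero,
      zero_sub, neg_pow s]
    ring_nf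
  have hend : g (s - s) = W a := by simp [hg]
  rw [hsum, hend, sub_zero] at key
  refine key.trans (div_le_self (by positivity) ?_)
  exact_mod_cast Nat.one_le_iff_ne_zero.2 p.factorial_ne_zero

/-- A function that is smooth at a point agrees near it with a globally smooth function. -/
theorem ContDiffAt.exists_contDiff_eventuallyEq {E : Type*} [NormedAddCommGroup E]
    [InnerProductSpace ℝ E] {W : E → G} {a : E} {N : ℕ} (hW : ContDiffAt ℝ N W a) :
    ∃ V : E → G, ContDiff ℝ N V ∧ V =ᶠ[𝓝 a] W := by
  obtain ⟨u, hu, hWu⟩ := hW.contDiffOn (m := N) le_rfl (by simp)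
  obtain ⟨r, hr, hru⟩ := Metric.mem_nhds_iff.1 (by simpa using hu : u ∈ 𝓝 a)
  -- The support lies in the closed ball of radius `r / 2`, well inside the ball where `W` is
  -- smooth, so `b • W` vanishes near every point outside the latter.
  let b : ContDiffBump a := ⟨r / 4, r / 2, by positivity, by linarith⟩
  refine ⟨fun x => b x • W x, contDiff_iff_contDiffAt.2 fun x => ?_, ?_⟩
  · by_cases hx : x ∈ Metric.ball a r
    · exact b.contDiffAt.smul (hWu.contDiffAt
        (Filter.mem_of_superset (Metric.isOpen_ball.mem_nhds hx) hru))
    · have h0 : x ∉ tsupport b := by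
        rw [b.tsupport_eq]
        intro h
        exact hx (Metric.closedBall_subset_ball (by simp only [b]; linarith) h)
      refine (contDiffAt_const (c := (0 : G))).congr_of_eventuallyEq ?_
      filter_upwards [notMem_tsupport_iff_eventuallyEq.1 h0] with y hy
      simp [hy]
  · filter_upwards [b.eventuallyEq_one] with x hx
    simp [hx]

/-- Inverse function theorem with a globally defined smooth local inverse. -/
theorem exists_contDiff_localInverse {E : Type*} [NormedAddCommGroup E]
    [InnerProductSpace ℝ E] [CompleteSpace E] {F : E → E} {N : ℕ} (hN : N ≠ 0) (hF : ContDiff ℝ N F)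
    {a b : E} (hab : F a = b) (hinv : (fderiv ℝ F a).IsInvertible) :
    ∃ W : E → E, ContDiff ℝ N W ∧ W b = a ∧ (∀ᶠ r in 𝓝 b, F (W r) = r) ∧
      ∀ᶠ w in 𝓝 a, W (F w) = w := by
  subst hab
  obtain ⟨e, he⟩ := hinv
  have hN' : ((N : ℕ) : WithTop ℕ∞) ≠ 0 := by exact_mod_cast hN
  have hd : HasFDerivAt F (e : E →L[ℝ] E) a := by
    rw [he]
    exact (hF.differentiable hN' a).hasFDerivAt
  have hs := hF.contDiffAt.hasStrictFDerivAt' hd hN'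
  -- A globally smooth representative lets the Taylor estimate use compactness on whole balls.
  obtain ⟨W, hW, hWe⟩ := (hF.contDiffAt.to_localInverse hd hN').exists_contDiff_eventuallyEq
  refine ⟨W, hW, ?_, ?_, ?_⟩
  · rw [hWe.self_of_nhds]
    exact hF.contDiffAt.localInverse_apply_image hd hN'
  · filter_upwards [hWe, hs.eventually_right_inverse] with r h1 h2
    rw [h1]
    exact h2
  · filter_upwards [hF.continuous.continuousAt.eventually hWe, hs.eventually_left_inverse]
      with w h1 h2
    rw [h1]
    exact h2

/-- A point at which a smooth map has invertible derivative has a neighbourhood of such points. -/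
theorem eventually_isInvertible_fderiv [CompleteSpace E] {F : E → E} (hF : ContDiff ℝ 1 F) {a : E}
    (hinv : (fderiv ℝ F a).IsInvertible) : ∀ᶠ w in 𝓝 a, (fderiv ℝ F w).IsInvertible := by
  obtain ⟨e, he⟩ := hinv
  have := (hF.continuous_fderiv one_ne_zero).continuousAt (x := a)
  rw [ContinuousAt, ← he] at this
  filter_upwards [this.eventually (ContinuousLinearEquiv.nhds e)] with w hw
  exact hw

end Analysis

/-! ### The residual, its Jacobian, and nonsingularity at the solution -/

section Residual

variable {n mI mE : ℕ}

/-- The projection `w ↦ x`. -/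
noncomputable def primalCLM (n mI mE : ℕ) : PrimalDual n mI mE →L[ℝ] EuclideanSpace ℝ (Fin n) :=
  LinearMap.toContinuousLinearMap
    { toFun := primal
      map_add' := fun _ _ => rfl
      map_smul' := fun _ _ => rfl }

/-- The projection `w ↦ λ_i`. -/
noncomputable def dualCLM (n mI mE : ℕ) (i : Fin mI ⊕ Fin mE) : PrimalDual n mI mE →L[ℝ] ℝ :=
  EuclideanSpace.proj (Sum.inr i)

@[simp] theorem primalCLM_apply (w : PrimalDual n mI mE) : primalCLM n mI mE w = primal w := rfl

@[simp] theorem dualCLM_apply (w : PrimalDual n mI mE) (i : Fin mI ⊕ Fin mE) :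
    dualCLM n mI mE i w = dual w i := rfl

theorem contDiff_primal {N : WithTop ℕ∞} : ContDiff ℝ N (primal : PrimalDual n mI mE → _) :=
  (primalCLM n mI mE).contDiff

theorem contDiff_dual {N : WithTop ℕ∞} (i : Fin mI ⊕ Fin mE) :
    ContDiff ℝ N (fun w : PrimalDual n mI mE => dual w i) :=
  (dualCLM n mI mE i).contDiff

theorem eq_zero_of_primal_dual {w : PrimalDual n mI mE} (h1 : primal w = 0)
    (h2 : ∀ i, dual w i = 0) : w = 0 := by
  ext i
  rcases i with i | i
  · exact congrArg (fun x : EuclideanSpace ℝ (Fin n) => x i) h1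
  · exact h2 i

theorem gradient_apply {ι : Type*} [Fintype ι] [DecidableEq ι] (g : EuclideanSpace ℝ ι → ℝ)
    (x : EuclideanSpace ℝ ι) (i : ι) :
    gradient g x i = fderiv ℝ g x (EuclideanSpace.single i 1) := by
  rw [← inner_gradient_left, EuclideanSpace.inner_single_right]
  simp

namespace NLP

variable (P : NLP n mI mE)

theorem residual_eq_sub (m : ℝ) (w : PrimalDual n mI mE) :
    P.residual m w = P.residual 0 w - m • barrierDirection n mI mE := by
  ext i
  rcases i with i | i | i <;> simp [residual, barrierDirection]

theorem IsKKT.residual_eq_zero {P : NLP n mI mE} {w : PrimalDual n mI mE} (h : P.IsKKT w) :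
    P.residual 0 w = 0 := by
  ext i
  rcases i with i | i | i
  · simp [residual, h.stationary]
  · simp [residual, h.complementary]
  · simp [residual, h.eq_feasible]

variable {P}

theorem IsSmooth.contDiff_residual {d N : ℕ} (hP : P.IsSmooth d) (hN : N + 1 ≤ d) (m : ℝ) :
    ContDiff ℝ N (P.residual m) := by
  have hgrad : ∀ g : EuclideanSpace ℝ (Fin n) → ℝ, ContDiff ℝ d g → ∀ i,
      ContDiff ℝ N (fun w : PrimalDual n mI mE => gradient g (primal w) i) := by
    intro g hg i
    simp only [gradient_apply]
    have h : ContDiff ℝ N (fderiv ℝ g) := hg.fderiv_right (by exact_mod_cast hN)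
    exact (h.comp contDiff_primal).clm_apply contDiff_const
  have hc : ∀ i, ContDiff ℝ N (fun w : PrimalDual n mI mE => P.c i (primal w)) := fun i =>
    ((hP.2 i).of_le (by exact_mod_cast (by omega : N ≤ d))).comp contDiff_primal
  rw [contDiff_euclidean]
  rintro (i | i | i)
  · exact (hgrad _ hP.1 i).sub (ContDiff.sum fun j _ => (contDiff_dual j).mul (hgrad _ (hP.2 j) i))
  · exact ((hc _).mul (contDiff_dual _)).sub contDiff_const
  · exact hc _

/-- The inner product of the stationarity block of the residual with a fixed vector. -/
theorem inner_primal_residual (m : ℝ) (w : PrimalDual n mI mE) (v : EuclideanSpace ℝ (Fin n)) :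
    inner ℝ (primal (P.residual m w)) v =
      fderiv ℝ P.f (primal w) v - ∑ j, dual w j * fderiv ℝ (P.c j) (primal w) v := by
  have h : primal (P.residual m w) =
      gradient P.f (primal w) - ∑ j, dual w j • gradient (P.c j) (primal w) := by
    ext i
    simp [primal, residual]
  rw [h, inner_sub_left, sum_inner, inner_gradient_left]
  simp only [inner_smul_left, inner_gradient_left]
  simp

theorem hasFDerivAt_fderiv_apply {g : EuclideanSpace ℝ (Fin n) → ℝ} (hg : ContDiff ℝ 2 g)
    (w : PrimalDual n mI mE) (v : EuclideanSpace ℝ (Fin n)) :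
    HasFDerivAt (fun w : PrimalDual n mI mE => fderiv ℝ g (primal w) v)
      (((fderiv ℝ (fderiv ℝ g) (primal w)).flip v).comp (primalCLM n mI mE)) w := by
  have h1 : Differentiable ℝ (fderiv ℝ g) :=
    (hg.fderiv_right (m := 1) (by norm_num)).differentiable one_ne_zero
  have h2 : HasFDerivAt (fun w : PrimalDual n mI mE => fderiv ℝ g (primal w))
      ((fderiv ℝ (fderiv ℝ g) (primal w)).comp (primalCLM n mI mE)) w :=
    (h1 (primal w)).hasFDerivAt.comp w (primalCLM n mI mE).hasFDerivAt
  exact (h2.clm_apply (hasFDerivAt_const v w)).congr_fderiv (by ext; simp)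

theorem IsSmooth.hessianForm_eq (hP : P.IsSmooth 2) (x v : EuclideanSpace ℝ (Fin n))
    (l : Fin mI ⊕ Fin mE → ℝ) :
    P.hessianForm x l v = fderiv ℝ (fderiv ℝ P.f) x v v -
      ∑ j, l j * fderiv ℝ (fderiv ℝ (P.c j)) x v v := by
  have hd : ∀ g : EuclideanSpace ℝ (Fin n) → ℝ, ContDiff ℝ (2 : ℕ) g → Differentiable ℝ g :=
    fun g hg => hg.differentiable (by norm_num)
  have hd' : ∀ g : EuclideanSpace ℝ (Fin n) → ℝ, ContDiff ℝ (2 : ℕ) g →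
      Differentiable ℝ (fderiv ℝ g) :=
    fun g hg => (hg.fderiv_right (m := 1) (by norm_num)).differentiable one_ne_zero
  have h1 : (fun y => fderiv ℝ (fun z => P.lagrangian z l) y) =
      fun y => fderiv ℝ P.f y - ∑ j, l j • fderiv ℝ (P.c j) y := by
    ext1 y
    refine HasFDerivAt.fderiv ?_
    exact (hd _ hP.1 y).hasFDerivAt.sub
      (HasFDerivAt.fun_sum fun j _ => ((hd _ (hP.2 j) y).hasFDerivAt.const_mul (l j)))
  have h2 : HasFDerivAt (fun y => fderiv ℝ P.f y - ∑ j, l j • fderiv ℝ (P.c j) y)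
      (fderiv ℝ (fderiv ℝ P.f) x - ∑ j, l j • fderiv ℝ (fderiv ℝ (P.c j)) x) x :=
    (hd' _ hP.1 x).hasFDerivAt.sub
      (HasFDerivAt.fun_sum fun j _ => ((hd' _ (hP.2 j) x).hasFDerivAt.const_smul (l j)))
  rw [hessianForm, h1, h2.fderiv]
  simp

theorem IsSmooth.hasFDerivAt_residual (hP : P.IsSmooth 2) (w : PrimalDual n mI mE) :
    HasFDerivAt (P.residual 0) (P.jacobian w) w :=
  ((hP.contDiff_residual (N := 1) (by norm_num) 0).differentiable (by norm_num) w).hasFDerivAt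

/-- Pairing the stationarity block with a fixed `v` keeps second derivatives as bilinear forms,
ready for comparison with `hessianForm`. The formula follows by differentiating
`inner_primal_residual` in two ways. -/
theorem IsSmooth.inner_primal_jacobian (hP : P.IsSmooth 2) (w δ : PrimalDual n mI mE)
    (v : EuclideanSpace ℝ (Fin n)) :
    inner ℝ (primal (P.jacobian w δ)) v =
      fderiv ℝ (fderiv ℝ P.f) (primal w) (primal δ) v -
        ∑ j, (dual w j * fderiv ℝ (fderiv ℝ (P.c j)) (primal w) (primal δ) v +
          fderiv ℝ (P.c j) (primal w) v * dual δ j) := by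
  have h1 : HasFDerivAt (fun w => inner ℝ (primal (P.residual 0 w)) v)
      (((innerSL ℝ v).comp (primalCLM n mI mE)).comp (P.jacobian w)) w := by
    have := ((innerSL ℝ v).comp (primalCLM n mI mE)).hasFDerivAt.comp w (hP.hasFDerivAt_residual w)
    refine this.congr_of_eventuallyEq (Eventually.of_forall fun y => ?_)
    simp [real_inner_comm]
  have h2 : HasFDerivAt (fun w : PrimalDual n mI mE => fderiv ℝ P.f (primal w) v -
      ∑ j, dual w j * fderiv ℝ (P.c j) (primal w) v) _ w :=
    (hasFDerivAt_fderiv_apply hP.1 w v).sub (HasFDerivAt.fun_sum fun j _ =>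
      ((dualCLM n mI mE j).hasFDerivAt.mul (hasFDerivAt_fderiv_apply (hP.2 j) w v)))
  simp only [inner_primal_residual] at h1
  have := congrArg (fun L => L δ) (h1.unique h2)
  simpa [sum_apply, real_inner_comm] using this

theorem IsSmooth.jacobian_apply_ineq (hP : P.IsSmooth 2) (w δ : PrimalDual n mI mE) (i : Fin mI) :
    dual (P.jacobian w δ) (Sum.inl i) =
      P.c (Sum.inl i) (primal w) * dual δ (Sum.inl i) +
        dual w (Sum.inl i) * fderiv ℝ (P.c (Sum.inl i)) (primal w) (primal δ) := by
  have h1 := (dualCLM n mI mE (Sum.inl i)).hasFDerivAt.comp w (hP.hasFDerivAt_residual w)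
  have hc : HasFDerivAt (fun w : PrimalDual n mI mE => P.c (Sum.inl i) (primal w)) _ w :=
    ((hP.2 (Sum.inl i)).differentiable (by norm_num) (primal w)).hasFDerivAt.comp w
      (primalCLM n mI mE).hasFDerivAt
  have h2 : HasFDerivAt (fun w : PrimalDual n mI mE =>
      P.c (Sum.inl i) (primal w) * dual w (Sum.inl i) - 0) _ w :=
    (hc.mul (dualCLM n mI mE (Sum.inl i)).hasFDerivAt).sub_const 0
  have := congrArg (fun L => L δ) (h1.unique h2)
  simpa using this

theorem IsSmooth.jacobian_apply_eq (hP : P.IsSmooth 2) (w δ : PrimalDual n mI mE) (i : Fin mE) :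
    dual (P.jacobian w δ) (Sum.inr i) =
      fderiv ℝ (P.c (Sum.inr i)) (primal w) (primal δ) := by
  have h1 := (dualCLM n mI mE (Sum.inr i)).hasFDerivAt.comp w (hP.hasFDerivAt_residual w)
  have h2 : HasFDerivAt (fun w : PrimalDual n mI mE => P.c (Sum.inr i) (primal w)) _ w :=
    ((hP.2 (Sum.inr i)).differentiable (by norm_num) (primal w)).hasFDerivAt.comp w
      (primalCLM n mI mE).hasFDerivAt
  have := congrArg (fun L => L δ) (h1.unique h2)
  simpa using this

/-- The Jacobian is nonsingular at a KKT point that satisfies the regularity conditions. -/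
theorem IsKKT.isInvertible_jacobian {w : PrimalDual n mI mE} (h : P.IsKKT w) (hP : P.IsSmooth 2)
    (hLICQ : P.LICQ (primal w)) (hSC : P.StrictComplementarity w) (hSOSC : P.StrongSecondOrder w) :
    (P.jacobian w).IsInvertible := by
  have hinj : Function.Injective (P.jacobian w : PrimalDual n mI mE →ₗ[ℝ] PrimalDual n mI mE) := by
    rw [← LinearMap.ker_eq_bot, LinearMap.ker_eq_bot']
    intro δ hδ
    replace hδ : P.jacobian w δ = 0 := hδ
    have hactive : ∀ i, P.c i (primal w) = 0 →
        fderiv ℝ (P.c i) (primal w) (primal δ) = 0 := by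
      rintro (i | i) hi
      · have := hP.jacobian_apply_ineq w δ i
        rw [hδ, hi, zero_mul, zero_add] at this
        exact (mul_eq_zero.1 this.symm).resolve_left (hSC i hi).ne'
      · rw [← hP.jacobian_apply_eq, hδ]
        rfl
    have hinactive : ∀ i, P.c i (primal w) ≠ 0 → dual δ i = 0 := by
      rintro (i | i) hi
      · have := hP.jacobian_apply_ineq w δ i
        rw [hδ, (mul_eq_zero.1 (h.complementary i)).resolve_left hi, zero_mul, add_zero] at this
        exact (mul_eq_zero.1 this.symm).resolve_left hi
      · exact absurd (h.eq_feasible i) hi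
    -- Pairing the stationarity row with `δx` itself kills every multiplier term: active gradients
    -- annihilate `δx`, inactive multipliers have `δλ = 0`. What remains is `δxᵀ H δx = 0`.
    have hx : primal δ = 0 := by
      obtain ⟨ω, hω, hpos⟩ := hSOSC
      have h1 := hpos (primal δ) fun i hi => by rw [inner_gradient_left]; exact hactive i hi
      have h2 := hP.inner_primal_jacobian w δ (primal δ)
      have h3 : ∀ j, fderiv ℝ (P.c j) (primal w) (primal δ) * dual δ j = 0 := fun j => by
        by_cases hj : P.c j (primal w) = 0
        · rw [hactive j hj, zero_mul]
        · rw [hinactive j hj, mul_zero]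
      simp only [h3, add_zero] at h2
      rw [← hP.hessianForm_eq, hδ] at h2
      have h4 : inner ℝ (primal (0 : PrimalDual n mI mE)) (primal δ) = 0 := inner_zero_left _
      rw [← h2, h4] at h1
      have h5 : ‖primal δ‖ ^ 2 = 0 := by nlinarith [sq_nonneg ‖primal δ‖]
      simpa using h5
    refine eq_zero_of_primal_dual hx fun i => ?_
    by_cases hi : P.c i (primal w) = 0
    · have hsum : ∑ j : {i // P.c i (primal w) = 0},
          dual δ j.1 • gradient (P.c j.1) (primal w) = 0 := by
        refine ext_inner_right ℝ fun v => ?_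
        have h2 := hP.inner_primal_jacobian w δ v
        have h4 : inner ℝ (primal (0 : PrimalDual n mI mE)) v = 0 := inner_zero_left _
        simp only [hδ, hx, h4, map_zero, zero_apply, mul_zero, zero_add,
          zero_sub, zero_eq_neg] at h2
        rw [sum_inner, inner_zero_left]
        simp only [inner_smul_left, inner_gradient_left]
        refine (Fintype.sum_of_injective Subtype.val Subtype.val_injective _
          (fun j => fderiv ℝ (P.c j) (primal w) v * dual δ j) (fun j hj => ?_)
          fun j => mul_comm _ _).trans h2
        rw [hinactive j fun h0 => hj ⟨⟨j, h0⟩, rfl⟩, mul_zero]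
      exact Fintype.linearIndependent_iff.1 hLICQ _ hsum ⟨i, hi⟩
    · exact hinactive i hi
  exact ⟨(LinearEquiv.ofInjectiveEndo _ hinj).toContinuousLinearEquiv, by ext; rfl⟩

end NLP

end Residual

/-! ### Transfer of convergence orders from the barrier parameters -/

section Sequences

theorem isBigO_comp_add_one_iff {E G : Type*} [NormedAddCommGroup E] [NormedAddCommGroup G]
    {f : ℕ → E} {g : ℕ → G} :
    (fun k => f (k + 1)) =O[atTop] (fun k => g (k + 1)) ↔ f =O[atTop] g := by
  conv_rhs => rw [← Filter.map_add_atTop_eq_nat 1, isBigO_map]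
  rfl

theorem isTheta_comp_add_one_iff {E G : Type*} [NormedAddCommGroup E] [NormedAddCommGroup G]
    {f : ℕ → E} {g : ℕ → G} :
    (fun k => f (k + 1)) =Θ[atTop] (fun k => g (k + 1)) ↔ f =Θ[atTop] g :=
  and_congr isBigO_comp_add_one_iff isBigO_comp_add_one_iff

/-- A sequence of errors of the same order as a positive null sequence of order `κ` has
Q-order `κ`. -/
theorem qConvergesWithOrder_of_isTheta {κ : ℝ} (hκ : 0 ≤ κ) {μ u : ℕ → ℝ} {a : ℝ}
    (hpos : ∀ k, 0 < μ k) (hμ : Tendsto μ atTop (𝓝 0))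
    (horder : (fun k => μ (k + 1)) =Θ[atTop] fun k => μ k ^ κ)
    (h : (fun k => u (k + 1) - a) =Θ[atTop] μ) : QConvergesWithOrder κ u a := by
  refine ⟨?_, ?_, ?_⟩
  · rw [← tendsto_add_atTop_iff_nat 1, ← tendsto_sub_nhds_zero_iff]
    exact h.isBigO.trans_tendsto hμ
  · obtain ⟨c, hc⟩ := h.isBigO_symm.bound
    obtain ⟨K, hK⟩ := eventually_atTop.1 hc
    refine eventually_atTop.2 ⟨K + 1, fun k hk he => ?_⟩
    have := hK (k - 1) (by omega)
    rw [Nat.sub_add_cancel (by omega), he, sub_self, norm_zero, mul_zero] at this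
    exact (norm_pos_iff.2 (hpos _).ne').not_ge this
  · rw [← isTheta_comp_add_one_iff]
    have h1 : (fun k => |u (k + 1) - a|) =Θ[atTop] μ := h.norm_left
    have h2 : (fun k => |u (k + 1) - a| ^ κ) =Θ[atTop] fun k => μ k ^ κ :=
      ⟨h1.1.rpow hκ (Eventually.of_forall fun k => (hpos k).le),
        h1.2.rpow hκ (Eventually.of_forall fun k => abs_nonneg _)⟩
    exact ((isTheta_comp_add_one_iff.2 h).trans horder).trans h2.symm

theorem rConvergesWithOrder_of_isBigO {κ : ℝ} (hκ : 0 ≤ κ) {μ u : ℕ → ℝ} {a : ℝ}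
    (hpos : ∀ k, 0 < μ k) (hμ : Tendsto μ atTop (𝓝 0))
    (horder : (fun k => μ (k + 1)) =Θ[atTop] fun k => μ k ^ κ)
    (h : (fun k => u (k + 1) - a) =O[atTop] μ) : RConvergesWithOrder κ u a := by
  obtain ⟨c, hc, hb⟩ := h.exists_pos
  obtain ⟨K, hK⟩ := eventually_atTop.1 hb.bound
  -- Domination is required for all `k`, so the early terms are the errors themselves.
  refine ⟨fun k => if K + 1 ≤ k then c * μ (k - 1) else |u k - a|, fun k => ?_,
    qConvergesWithOrder_of_isTheta hκ hpos hμ horder ?_⟩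
  · dsimp only
    split_ifs with hk
    · have := hK (k - 1) (by omega)
      rwa [Nat.sub_add_cancel (by omega), Real.norm_eq_abs, Real.norm_of_nonneg (hpos _).le] at this
    · exact le_rfl
  · have he : (fun k => (if K + 1 ≤ k + 1 then c * μ (k + 1 - 1) else |u (k + 1) - a|) - 0)
        =ᶠ[atTop] fun k => c * μ k := by
      filter_upwards [eventually_ge_atTop K] with k hk
      simp [hk]
    exact he.trans_isTheta ((isTheta_refl μ atTop).const_mul_left hc.ne')

theorem isLittleO_natPow_rpow {κ : ℝ} {N : ℕ} (hκ : κ < N) {μ : ℕ → ℝ} (hpos : ∀ k, 0 < μ k)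
    (hμ : Tendsto μ atTop (𝓝 0)) : (fun k => μ k ^ N) =o[atTop] fun k => μ k ^ κ := by
  rw [isLittleO_iff_tendsto' (Eventually.of_forall fun k h =>
    absurd h (Real.rpow_pos_of_pos (hpos k) κ).ne')]
  have h1 : Tendsto (fun k => μ k ^ ((N : ℝ) - κ)) atTop (𝓝 0) := by
    have := hμ.rpow_const (p := (N : ℝ) - κ) (Or.inr (sub_pos.2 hκ).le)
    rwa [Real.zero_rpow (sub_pos.2 hκ).ne'] at this
  refine h1.congr fun k => ?_
  rw [Real.rpow_sub (hpos k), Real.rpow_natCast]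

end Sequences

/-! ### The extrapolation step near the solution -/

namespace NLP

variable {n mI mE : ℕ} {P : NLP n mI mE}

theorem IsRun.barrier_pos {p : ℕ} {ε φ : ℝ → ℝ} {μ : ℕ → ℝ} {w wbar : ℕ → PrimalDual n mI mE}
    (h : P.IsRun p ε φ μ w wbar) (hφ : ∀ t, 0 < t → 0 < φ t) (k : ℕ) : 0 < μ k := by
  induction k with
  | zero => exact h.initial_pos
  | succ k ih => rw [h.update]; exact hφ _ ih

theorem norm_nml_le_one (r : PrimalDual n mI mE) : ‖nml r‖ ≤ 1 := by
  rw [nml, norm_smul, norm_inv, norm_norm]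
  exact inv_mul_le_one

/-- Near a point with a local inverse `W` of the residual, the extrapolation curve is the image
of a segment under `W`. -/
theorem IsExtrapolation.eq_sum {p : ℕ} {m : ℝ} {w w' : PrimalDual n mI mE}
    (h : P.IsExtrapolation p m w w') {W : PrimalDual n mI mE → PrimalDual n mI mE}
    (hW : ∀ᶠ x in 𝓝 w, W (P.residual 0 x) = x) :
    w' = ∑ q ∈ Finset.range (p + 1),
      ((q.factorial : ℝ)⁻¹ * (0 - ‖P.residual m w‖) ^ q) •
        iteratedDeriv q (fun ρ : ℝ => W (m • barrierDirection n mI mE +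
          ρ • nml (P.residual m w))) ‖P.residual m w‖ := by
  obtain ⟨u, hu, huw, hures, rfl⟩ := h
  have hcont := hu.continuousAt
  rw [ContinuousAt, huw] at hcont
  -- By continuity `u` stays where `W` inverts `F^0`, hence `u = W ∘ F^0 ∘ u`, and `F^0(u(ρ))` is
  -- the segment.
  have he : u =ᶠ[𝓝 ‖P.residual m w‖] fun ρ : ℝ => W (m • barrierDirection n mI mE +
      ρ • nml (P.residual m w)) := by
    filter_upwards [hures, hcont.eventually hW] with ρ h1 h2
    rw [← h1, residual_eq_sub, add_sub_cancel, h2]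
  exact Finset.sum_congr rfl fun q _ => by rw [he.iteratedDeriv_eq q]

/-- The extrapolation error is of order `p + 1` in the norm of the residual. -/
theorem exists_norm_extrapolation_sub_le {W : PrimalDual n mI mE → PrimalDual n mI mE} {p : ℕ}
    (hW : ContDiff ℝ (p + 1 : ℕ) W) :
    ∃ C, 0 ≤ C ∧ ∀ (m : ℝ) (w w' : PrimalDual n mI mE), P.IsExtrapolation p m w w' →
      (∀ᶠ x in 𝓝 w, W (P.residual 0 x) = x) → ‖m • barrierDirection n mI mE‖ ≤ 1 →
      ‖P.residual m w‖ ≤ 1 →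
      ‖w' - W (m • barrierDirection n mI mE)‖ ≤ C * ‖P.residual m w‖ ^ (p + 1) := by
  obtain ⟨C, hC, h⟩ := exists_norm_taylor_line_sub_le hW 1
  refine ⟨C, hC, fun m w w' hw' hloc hm hr => ?_⟩
  rw [hw'.eq_sum hloc]
  exact h _ _ _ hm (norm_nml_le_one _) (norm_nonneg _) hr

/-- Ultimately, the extrapolation step from an iterate near the solution is accepted and leads to
another iterate near the solution, which is very close to the barrier trajectory. -/
theorem IsRun.exists_ball_step {p : ℕ} {ε φ : ℝ → ℝ} {μ : ℕ → ℝ}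
    {w wbar : ℕ → PrimalDual n mI mE} (hrun : P.IsRun p ε φ μ w wbar)
    (hF : ContDiff ℝ 1 (P.residual 0)) {wstar : PrimalDual n mI mE}
    (hinv : (P.jacobian wstar).IsInvertible)
    {W : PrimalDual n mI mE → PrimalDual n mI mE} (hW : ContDiff ℝ (p + 1 : ℕ) W)
    (hW0 : W 0 = wstar) (hFW : ∀ᶠ r in 𝓝 0, P.residual 0 (W r) = r)
    (hWF : ∀ᶠ x in 𝓝 wstar, W (P.residual 0 x) = x)
    (hpos : ∀ k, 0 < μ k) (hμ : Tendsto μ atTop (𝓝 0))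
    (hε_pos : ∀ t, 0 < t → 0 < ε t) (hε : (fun k => ε (μ k)) =Θ[atTop] μ)
    (hμO : (fun k => μ (k + 1)) =O[atTop] μ)
    (hμo : (fun k => μ k ^ (p + 1)) =o[atTop] fun k => μ (k + 1)) :
    ∃ η > 0, ∃ C, ∀ᶠ k in atTop, w (k + 1) ∈ Metric.ball wstar η →
      (P.jacobian (w (k + 1))).IsInvertible ∧
      ‖P.residual (μ (k + 1)) (wbar (k + 1))‖ ≤ ε (μ (k + 1)) ∧ w (k + 2) = wbar (k + 1) ∧
      w (k + 2) ∈ Metric.ball wstar η ∧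
      ‖w (k + 2) - W (μ (k + 1) • barrierDirection n mI mE)‖ ≤ C * μ k ^ (p + 1) := by
  set e := barrierDirection n mI mE
  obtain ⟨L, S, hS, hL⟩ := (hF.contDiffAt (x := wstar)).exists_lipschitzOnWith
  obtain ⟨η, hη, hball⟩ := Metric.mem_nhds_iff.1 (inter_mem hS
    (inter_mem (eventually_isInvertible_fderiv hF hinv) hWF))
  obtain ⟨C₁, hC₁, hext⟩ := exists_norm_extrapolation_sub_le (P := P) hW
  obtain ⟨A, hA⟩ := hε.isBigO.bound
  obtain ⟨B, hB⟩ := hμO.bound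
  -- `A` bounds `ε(μ_k) / μ_k` and `B` bounds `μ_{k+1} / μ_k`; changing the barrier parameter moves
  -- the residual by `|μ_k - μ_{k+1}| ‖e‖`, so `D μ_k` bounds the new one.
  set D : ℝ := A + (1 + B) * ‖e‖ with hD
  have hμ1 : Tendsto (fun k => μ (k + 1)) atTop (𝓝 0) := (tendsto_add_atTop_iff_nat 1).2 hμ
  have hμe : Tendsto (fun k => μ (k + 1) • e) atTop (𝓝 0) := by
    simpa using hμ1.smul_const e
  have hWe : Tendsto (fun k => W (μ (k + 1) • e)) atTop (𝓝 wstar) := by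
    have := (hW.continuous.tendsto 0).comp hμe
    rwa [hW0] at this
  have hsmall : Tendsto (fun k => C₁ * D ^ (p + 1) * μ k ^ (p + 1)) atTop (𝓝 0) := by
    simpa using (hμ.pow (p + 1)).const_mul (C₁ * D ^ (p + 1))
  have hε1 : (fun k => μ (k + 1)) =O[atTop] fun k => ε (μ (k + 1)) :=
    (isTheta_comp_add_one_iff.2 hε).isBigO_symm
  have hacc : ∀ᶠ k in atTop, L * (C₁ * D ^ (p + 1) * μ k ^ (p + 1)) ≤ ε (μ (k + 1)) := by
    have h1 := ((hμo.trans_isBigO hε1).const_mul_left (L * (C₁ * D ^ (p + 1)))).bound one_pos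
    filter_upwards [h1] with k hk
    rw [one_mul, Real.norm_of_nonneg (hε_pos _ (hpos _)).le, mul_assoc] at hk
    exact (le_abs_self _).trans hk
  refine ⟨η, hη, C₁ * D ^ (p + 1), ?_⟩
  filter_upwards [hA, hB, hacc, hμe.eventually hFW,
    hμe.eventually (Metric.closedBall_mem_nhds 0 one_pos),
    hWe.eventually (Metric.ball_mem_nhds wstar (half_pos hη)),
    hsmall.eventually (eventually_lt_nhds (half_pos hη)),
    (show Tendsto (fun k => D * μ k) atTop (𝓝 0) by simpa using hμ.const_mul D).eventually
      (eventually_lt_nhds one_pos)]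
    with k hAk hBk hacck hFWk hek hWk hsk hDk hwk
  rw [Real.norm_of_nonneg (hε_pos _ (hpos _)).le, Real.norm_of_nonneg (hpos _).le] at hAk
  rw [Real.norm_of_nonneg (hpos _).le, Real.norm_of_nonneg (hpos _).le] at hBk
  have hinvk : (P.jacobian (w (k + 1))).IsInvertible := (hball hwk).2.1
  have hr : ‖P.residual (μ (k + 1)) (w (k + 1))‖ ≤ D * μ k := by
    have h1 : P.residual (μ (k + 1)) (w (k + 1)) =
        P.residual (μ k) (w (k + 1)) + (μ k - μ (k + 1)) • e := by
      rw [residual_eq_sub, residual_eq_sub P (μ k), sub_smul]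
      abel
    rw [h1]
    refine (norm_add_le _ _).trans ?_
    have h2 : |μ k - μ (k + 1)| ≤ (1 + B) * μ k := by
      rw [abs_le]
      constructor <;> nlinarith [hpos k, hpos (k + 1)]
    rw [norm_smul, Real.norm_eq_abs]
    nlinarith [hrun.terminate k, norm_nonneg e, mul_le_mul_of_nonneg_right h2 (norm_nonneg e)]
  have hloc : ∀ᶠ x in 𝓝 (w (k + 1)), W (P.residual 0 x) = x :=
    mem_of_superset (Metric.isOpen_ball.mem_nhds hwk) fun x hx => (hball hx).2.2
  have hwbar : ‖wbar (k + 1) - W (μ (k + 1) • e)‖ ≤ C₁ * D ^ (p + 1) * μ k ^ (p + 1) := by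
    refine (hext _ _ _ (hrun.extrapolate _ hinvk) hloc (mem_closedBall_zero_iff.1 hek)
      (hr.trans hDk.le)).trans ?_
    rw [mul_assoc, ← mul_pow]
    gcongr
  have hmem : wbar (k + 1) ∈ Metric.ball wstar η := by
    have h1 : dist (wbar (k + 1)) (W (μ (k + 1) • e)) < η / 2 := by
      rw [dist_eq_norm]
      exact hwbar.trans_lt hsk
    exact (dist_triangle _ _ _).trans_lt (by linarith [Metric.mem_ball.1 hWk])
  have hmem' : W (μ (k + 1) • e) ∈ Metric.ball wstar η :=
    Metric.ball_subset_ball (half_le_self hη.le) hWk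
  have haccept : ‖P.residual (μ (k + 1)) (wbar (k + 1))‖ ≤ ε (μ (k + 1)) := by
    refine le_trans ?_ hacck
    -- `F^{μ_{k+1}}` vanishes at the trajectory point, so the Lipschitz bound controls the residual
    -- at `wbar (k + 1)`.
    have h1 := hL.dist_le_mul _ (hball hmem).1 _ (hball hmem').1
    rw [hFWk, dist_eq_norm, dist_eq_norm, ← residual_eq_sub] at h1
    exact h1.trans (mul_le_mul_of_nonneg_left hwbar L.2)
  have hnext := hrun.accept _ haccept
  refine ⟨hinvk, haccept, hnext, ?_, ?_⟩
  · rw [hnext]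
    exact hmem
  · rw [hnext]
    exact hwbar

/-- Trajectory maps are unique near `0`. -/
theorem IsTrajectoryMap.eventuallyEq {d : ℕ} {wstar : PrimalDual n mI mE}
    {V W : PrimalDual n mI mE → PrimalDual n mI mE} (hV : P.IsTrajectoryMap d wstar V)
    (hWF : ∀ᶠ x in 𝓝 wstar, W (P.residual 0 x) = x) : V =ᶠ[𝓝 0] W := by
  have hc : Tendsto V (𝓝 0) (𝓝 wstar) := by
    have := hV.smooth.continuousAt
    rwa [ContinuousAt, hV.base] at this
  filter_upwards [hc.eventually hWF, hV.solves] with r h1 h2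
  rw [← h1, h2]

end NLP

/-! ### Global behaviour of the run and the convergence orders -/

theorem mainTheorem1 {n mI mE : ℕ} (P : NLP n mI mE) (d : ℕ) (hd : 3 ≤ d) (hP : P.IsSmooth d)
    (wstar : PrimalDual n mI mE) (hKKT : P.IsKKT wstar) (hLICQ : P.LICQ (primal wstar))
    (hSC : P.StrictComplementarity wstar) (hSOSC : P.StrongSecondOrder wstar)
    (p : ℕ) (hp1 : 1 ≤ p) (hpd : p ≤ d - 2) (κ : ℝ) (hκ : κ ∈ Set.Ioo (1 : ℝ) (p + 1))
    (ε φ : ℝ → ℝ) (hε_pos : ∀ t, 0 < t → 0 < ε t) (hφ_pos : ∀ t, 0 < t → 0 < φ t)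
    (hε : ε =Θ[𝓝[>] 0] (fun t => t)) (hφ : φ =Θ[𝓝[>] 0] (fun t => t ^ κ))
    (μ : ℕ → ℝ) (w wbar : ℕ → PrimalDual n mI mE) (hrun : P.IsRun p ε φ μ w wbar)
    (hμ : Tendsto μ atTop (𝓝 0))
    (s : ℕ → ℕ) (hs : StrictMono s) (hsub : Tendsto (fun i => w (s i + 1)) atTop (𝓝 wstar)) :
    Tendsto w atTop (𝓝 wstar) ∧
    (∀ᶠ k in atTop, (P.jacobian (w k)).IsInvertible ∧
      ‖P.residual (μ k) (wbar k)‖ ≤ ε (μ k) ∧ w (k + 1) = wbar k) ∧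
    (∀ j, RConvergesWithOrder κ (fun k => w k j) (wstar j)) ∧
    (∃ W, P.IsTrajectoryMap d wstar W) ∧
    (∀ W, P.IsTrajectoryMap d wstar W →
      ∀ j, deriv (fun t : ℝ => W (t • barrierDirection n mI mE)) 0 j ≠ 0 →
        QConvergesWithOrder κ (fun k => w k j) (wstar j)) := by
  have hκ0 : 0 ≤ κ := zero_le_one.trans hκ.1.le
  have hP2 : P.IsSmooth 2 :=
    ⟨hP.1.of_le (by exact_mod_cast (by omega : 2 ≤ d)),
      fun i => (hP.2 i).of_le (by exact_mod_cast (by omega : 2 ≤ d))⟩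
  have hinv := hKKT.isInvertible_jacobian hP2 hLICQ hSC hSOSC
  obtain ⟨W, hW, hW0, hFW, hWF⟩ := exists_contDiff_localInverse (N := d - 1) (by omega)
    (hP.contDiff_residual (by omega) 0) hKKT.residual_eq_zero hinv
  have hpos := hrun.barrier_pos hφ_pos
  have hμ' : Tendsto μ atTop (𝓝[>] 0) :=
    tendsto_nhdsWithin_iff.2 ⟨hμ, Eventually.of_forall hpos⟩
  have horder : (fun k => μ (k + 1)) =Θ[atTop] fun k => μ k ^ κ := by
    simp only [hrun.update]
    exact ⟨hφ.1.comp_tendsto hμ', hφ.2.comp_tendsto hμ'⟩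
  have hpow : (fun k => μ k ^ (p + 1)) =o[atTop] fun k => μ (k + 1) :=
    (isLittleO_natPow_rpow (by exact_mod_cast hκ.2) hpos hμ).trans_isTheta horder.symm
  have hμO : (fun k => μ (k + 1)) =O[atTop] μ := by
    refine horder.1.trans (IsBigO.of_bound 1 ?_)
    filter_upwards [hμ.eventually (eventually_lt_nhds one_pos)] with k hk
    rw [Real.norm_of_nonneg (hpos k).le, Real.norm_of_nonneg (Real.rpow_nonneg (hpos k).le _),
      one_mul]
    simpa using Real.rpow_le_rpow_of_exponent_ge (hpos k) hk.le hκ.1.le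
  obtain ⟨η, hη, C, hstep⟩ := hrun.exists_ball_step
    ((hP.contDiff_residual (N := 1) (by omega) 0).of_le (by norm_num)) hinv
    (hW.of_le (by exact_mod_cast (by omega : p + 1 ≤ d - 1))) hW0 hFW hWF hpos hμ hε_pos
    ⟨hε.1.comp_tendsto hμ', hε.2.comp_tendsto hμ'⟩ hμO hpow
  -- The subsequence enters the ball once after the step estimates have become valid; induction then
  -- keeps every later iterate inside.
  have hball : ∀ᶠ k in atTop, w (k + 1) ∈ Metric.ball wstar η := by
    obtain ⟨K, hK⟩ := eventually_atTop.1 hstep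
    obtain ⟨i, hi, hiK⟩ := ((hsub.eventually (Metric.ball_mem_nhds wstar hη)).and
      (hs.tendsto_atTop.eventually_ge_atTop K)).exists
    refine eventually_atTop.2 ⟨s i, fun k hk => ?_⟩
    induction k, hk using Nat.le_induction with
    | base => exact hi
    | succ k hk ih => exact (hK k (hiK.trans hk) ih).2.2.2.1
  have hlocal := hstep.mp (hball.mono fun k hk h => h hk)
  set e := barrierDirection n mI mE
  have htraj : (fun k => w (k + 1 + 1) - W (μ (k + 1) • e)) =o[atTop] fun k => μ (k + 1) := by
    refine IsBigO.trans_isLittleO (IsBigO.of_bound C ?_) hpow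
    filter_upwards [hlocal] with k hk
    rw [Real.norm_of_nonneg (pow_nonneg (hpos k).le _)]
    exact hk.2.2.2.2
  have hcurve : HasDerivAt (fun t : ℝ => W (t • e)) (deriv (fun t : ℝ => W (t • e)) 0) 0 := by
    have h1 : Differentiable ℝ W :=
      hW.differentiable (by exact_mod_cast (by omega : d - 1 ≠ 0))
    exact (h1.comp (differentiable_id.smul_const e) 0).hasDerivAt
  set a := deriv (fun t : ℝ => W (t • e)) 0 with ha
  have hlin : (fun k => w (k + 1 + 1) - wstar - μ (k + 1) • a) =o[atTop] fun k => μ (k + 1) := by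
    have h1 := hasDerivAt_iff_isLittleO.1 hcurve
    simp only [zero_smul, sub_zero, hW0] at h1
    have h2 := h1.comp_tendsto ((tendsto_add_atTop_iff_nat 1).2 hμ)
    refine (htraj.add h2).congr_left fun k => ?_
    simp only [Function.comp_apply]
    abel
  have hlinj : ∀ j, (fun k => w (k + 1 + 1) j - wstar j - μ (k + 1) * a j) =o[atTop]
      fun k => μ (k + 1) := fun j =>
    (IsBigO.of_bound 1 (Eventually.of_forall fun k => by
      rw [one_mul]
      exact PiLp.norm_apply_le (w (k + 1 + 1) - wstar - μ (k + 1) • a) j)).trans_isLittleO hlin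
  have hbigO : (fun k => w (k + 1 + 1) - wstar) =O[atTop] fun k => μ (k + 1) := by
    have h1 : (fun k => μ (k + 1) • a) =O[atTop] fun k => μ (k + 1) :=
      IsBigO.of_bound ‖a‖ (Eventually.of_forall fun k => by rw [norm_smul, mul_comm])
    exact (hlin.isBigO.add h1).congr_left fun k => sub_add_cancel _ _
  refine ⟨?_, ?_, fun j => ?_, ⟨W, hW.contDiffAt, hFW, hW0⟩, fun V hV j hj => ?_⟩
  · rw [← tendsto_add_atTop_iff_nat 2, ← tendsto_sub_nhds_zero_iff]
    exact hbigO.trans_tendsto ((tendsto_add_atTop_iff_nat 1).2 hμ)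
  · obtain ⟨K, hK⟩ := eventually_atTop.1 hlocal
    refine eventually_atTop.2 ⟨K + 1, fun k hk => ?_⟩
    obtain ⟨k, rfl⟩ : ∃ l, k = l + 1 := ⟨k - 1, by omega⟩
    have := hK k (by omega)
    exact ⟨this.1, this.2.1, this.2.2.1⟩
  · refine rConvergesWithOrder_of_isBigO hκ0 hpos hμ horder ?_
    refine isBigO_comp_add_one_iff.1 (IsBigO.trans (IsBigO.of_bound 1 ?_) hbigO)
    refine Eventually.of_forall fun k => ?_
    rw [one_mul]
    exact PiLp.norm_apply_le (w (k + 1 + 1) - wstar) j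
  -- Any trajectory map has the germ of `W` at `0`, hence the same tangent `a`; if `a j ≠ 0`, the
  -- linear term dominates the `o(μ_{k+1})` remainder.
  · have hVW := (hV.eventuallyEq hWF)
    have hVW' : (fun t : ℝ => V (t • e)) =ᶠ[𝓝 0] fun t => W (t • e) := by
      have h1 : Tendsto (fun t : ℝ => t • e) (𝓝 0) (𝓝 0) := by
        have : Continuous fun t : ℝ => t • e := by fun_prop
        simpa using this.tendsto 0
      exact h1.eventually hVW
    rw [hVW'.deriv_eq, ← ha] at hj
    refine qConvergesWithOrder_of_isTheta hκ0 hpos hμ horder (isTheta_comp_add_one_iff.1 ?_)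
    have h1 : (fun k => μ (k + 1) * a j) =Θ[atTop] fun k => μ (k + 1) := by
      simp only [mul_comm _ (a j)]
      exact (isTheta_refl _ _).const_mul_left hj
    have he : (fun k => w (k + 1 + 1) j - wstar j) =ᶠ[atTop] (fun k => μ (k + 1) * a j) +
        fun k => w (k + 1 + 1) j - wstar j - μ (k + 1) * a j :=
      Eventually.of_forall fun k => (add_sub_cancel _ _).symm
    exact he.trans_isTheta (h1.add_isLittleO (hlinj j))
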